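/- Let $A\in\mathbb R^{n\times m}$. Its $k$-restricted isometry constant $\sigma_k$ is the smallest $\delta\ge 0$ with $(1-\delta)\|x\|_2^2\le\|Ax\|_2^2\le(1+\delta)\|x\|_2^2$ for all $x\in\mathbb R^m$ having at most $k$ nonzero entries. Given $b\in\mathbb R^n$, $\lambda>0$ and an integer batch size $1\le\varrho\le m$, put $f(x)=\lambda\|x\|_1+\tfrac12\|b-Ax\|_2^2$. General matching pursuit (GMP) starts from $x^0=0$, $I_0=\emptyset$. In step $t\ge1$ it computes $g=A^\top(b-Ax^{t-1})$, chooses a set $J_t$ of $\varrho$ indices with the largest values $|g_j|$ (ties broken arbitrarily), sets $I_t=I_{t-1}\cup J_t$, and lets $x^t$ be a minimizer of $f$ among the vectors vanishing outside $I_t$, exactly or up to an additive error $\eta_t\ge0$ in the objective value with $\eta_t\to0$. The run is continued indefinitely. **Theorem.** For every $\nu>0$ there are constants $\varepsilon_0\in(0,1)$ and $C>0$, depending only on $\nu$, such that the following holds for all $n$, all $2\le k\le m$, every $A\in\mathbb R^{n\times m}$ with $\sigma_k\le 0.307-\nu$, every $\hat x\in\mathbb R^m$ with at most $k$ nonzero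 entries (with support $T$), and every $1\le\varrho\le m$. 1. Let $b=A\hat x+e$ with $e\in\mathbb R^n$, let $0<\varepsilon\le\varepsilon_0$, and let $\lambda>0$ satisfy $\|A^\top e\|_\infty\le\varepsilon\lambda$. Then every sequence $(x^t)$ generated by GMP has an accumulation point, and each accumulation point $x^*$ is a global minimizer of $f$ (a LASSO solution); its error $h=\hat x-x^*$ satisfies $\|h_{T^c}\|_1\le\frac{1+\varepsilon}{1-\varepsilon}\|h_T\|_1$ and $\|h\|_2\le C\sqrt k\,\lambda$. 2. Let $b=A\hat x$ (no noise). Then for every $\eta>0$ there is $\lambda_0>0$ such that, for all $0<\lambda\le\lambda_0$, every sequence generated by GMP has an accumulation point, and each accumulation point $x^*$ satisfies $\|\hat x-x^*\|_2\le\eta$. -/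

import Mathlib

open Filter Topology

namespace GMP

/-- Euclidean space `ℝ^d` with the `ℓ₂` norm. -/
abbrev E (d : ℕ) := EuclideanSpace ℝ (Fin d)

/-- The matrix-vector product `A x`, as a map between Euclidean spaces. -/
noncomputable def app {n m : ℕ} (A : Matrix (Fin n) (Fin m) ℝ) (x : E m) : E n :=
  WithLp.toLp 2 (A.mulVec x.ofLp)

/-- The `ℓ₁` norm. -/
def l1 {m : ℕ} (x : E m) : ℝ := ∑ i, |x i|

/-- The support `{i | x i ≠ 0}`. -/
noncomputable def supp {m : ℕ} (x : E m) : Finset (Fin m) :=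
  Finset.univ.filter (fun i => x i ≠ 0)

/-- `x` is `k`-sparse: `‖x‖₀ ≤ k`. -/
def Sparse {m : ℕ} (k : ℕ) (x : E m) : Prop := (supp x).card ≤ k

/-- The `k`-restricted isometry constant of `A`: the smallest `δ ≥ 0` such that
`(1 - δ) ‖x‖² ≤ ‖A x‖² ≤ (1 + δ) ‖x‖²` for all `k`-sparse `x`. -/
noncomputable def ric {n m : ℕ} (A : Matrix (Fin n) (Fin m) ℝ) (k : ℕ) : ℝ :=
  sInf {δ : ℝ | 0 ≤ δ ∧ ∀ x : E m, Sparse k x →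
    (1 - δ) * ‖x‖ ^ 2 ≤ ‖app A x‖ ^ 2 ∧ ‖app A x‖ ^ 2 ≤ (1 + δ) * ‖x‖ ^ 2}

/-- The LASSO objective `lam * ‖x‖₁ + ½ ‖b - A x‖²`. -/
noncomputable def objective {n m : ℕ} (A : Matrix (Fin n) (Fin m) ℝ) (b : E n) (lam : ℝ)
    (x : E m) : ℝ :=
  lam * l1 x + (1 / 2) * ‖b - app A x‖ ^ 2

/-- `x` is a global minimizer of the LASSO objective. -/
def IsLassoSolution {n m : ℕ} (A : Matrix (Fin n) (Fin m) ℝ) (b : E n) (lam : ℝ)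
    (x : E m) : Prop :=
  ∀ u : E m, objective A b lam x ≤ objective A b lam u

/-- The restricted set `{h | ‖h_{Tᶜ}‖₁ ≤ D ‖h_T‖₁}`. -/
def restrictedSet {m : ℕ} (T : Finset (Fin m)) (D : ℝ) : Set (E m) :=
  {h | ∑ i ∈ Tᶜ, |h i| ≤ D * ∑ i ∈ T, |h i|}

/-- `J` consists of `r` indices at which `|g j|` is largest (ties broken arbitrarily). -/
def IsTopSelection {m : ℕ} (r : ℕ) (g : E m) (J : Finset (Fin m)) : Prop :=
  J.card = r ∧ ∀ j ∈ J, ∀ i ∉ J, |g i| ≤ |g j|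

/-- A run of general matching pursuit with `ℓ₁` regularization parameter `lam`, batch size `r`
and data `b`. The iterates are `x t`, the residuals `b - A (x t)`, the index sets `I t`.
The batch `J (t + 1)` (the value `J 0` is not used) is the outcome of the worst-case analysis at
the residual of `x t`, and `x (t + 1)` solves the master problem, i.e. minimizes the LASSO objective
among the vectors vanishing outside `I (t + 1)`, up to a tolerance `tol (t + 1)`. The tolerances
tend to `0`; `tol = 0` is exact solution of the master problems. -/
structure IsRun {n m : ℕ} (A : Matrix (Fin n) (Fin m) ℝ) (b : E n) (lam : ℝ) (r : ℕ)
    (tol : ℕ → ℝ) (x : ℕ → E m) (I J : ℕ → Finset (Fin m)) : Prop where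
  tol_nonneg : ∀ t, 0 ≤ tol t
  tol_tendsto : Tendsto tol atTop (𝓝 0)
  x_zero : x 0 = 0
  I_zero : I 0 = ∅
  select : ∀ t, IsTopSelection r (app A.transpose (b - app A (x t))) (J (t + 1))
  I_succ : ∀ t, I (t + 1) = I t ∪ J (t + 1)
  supp_subset : ∀ t, supp (x (t + 1)) ⊆ I (t + 1)
  master : ∀ t, ∀ u : E m, supp u ⊆ I (t + 1) →
    objective A b lam (x (t + 1)) ≤ objective A b lam u + tol (t + 1)

end GMP

/-! The index sets increase inside a finite set, so they stabilize at some `I`. An accumulation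
point minimizes the objective on vectors supported in `I`, hence its correlations `|g j|` are at
most `lam` for `j ∈ I`. Late batches are nonempty and lie in `I`, so every index outside `I` is
dominated by one inside, and the same bound passes to the limit. By convexity, the bound on all
correlations makes the point a global minimizer (`IsRun.isLassoSolution`).

The error `h` of a LASSO solution lies in a restricted set with constant `D` close to `1`, and `AᵀA
h` is bounded by `2 * lam` entrywise. To bound `h`, let `S` carry its `k` largest entries and expand
`⟨A h_S, A h⟩ = ‖A h_S‖² + ⟨A h_S, A h_Sᶜ⟩`. The square is at least `(1 - δ) ‖h_S‖²`; the cross term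
is at most `(3/√2) δ D ‖h_S‖²` in absolute value, up to rounding. For `δ < 0.307` and `D ≤ 1.03` a
positive multiple of `‖h_S‖²` survives. The factor `3/√2` comes from averaging over cyclic windows
(`IsRIPBound.inner_le_of_card_le`), which needs isometry of order `k` only; the bathtub principle
carries it over to the non-sparse tail. -/

namespace GMP

/-! ### Linearity, continuity and norm inequalities -/

section Basic

variable {n m : ℕ}

theorem app_add (A : Matrix (Fin n) (Fin m) ℝ) (x y : E m) :
    app A (x + y) = app A x + app A y := by
  ext i; simp [app, Matrix.mulVec_add]

theorem app_sub (A : Matrix (Fin n) (Fin m) ℝ) (x y : E m) :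
    app A (x - y) = app A x - app A y := by
  ext i; simp [app, Matrix.mulVec_sub]

theorem app_smul (A : Matrix (Fin n) (Fin m) ℝ) (c : ℝ) (x : E m) :
    app A (c • x) = c • app A x := by
  ext i; simp [app, Matrix.mulVec_smul]

theorem app_zero (A : Matrix (Fin n) (Fin m) ℝ) : app A 0 = 0 := by
  ext i; simp [app]

theorem app_sum {ι : Type*} (A : Matrix (Fin n) (Fin m) ℝ) (s : Finset ι) (x : ι → E m) :
    app A (∑ i ∈ s, x i) = ∑ i ∈ s, app A (x i) :=
  map_sum (⟨⟨app A, app_zero A⟩, app_add A⟩ : E m →+ E n) x s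

theorem continuous_app (A : Matrix (Fin n) (Fin m) ℝ) : Continuous (app A) :=
  LinearMap.continuous_of_finiteDimensional
    (⟨⟨app A, app_add A⟩, app_smul A⟩ : E m →ₗ[ℝ] E n)

theorem exists_norm_app_le (A : Matrix (Fin n) (Fin m) ℝ) :
    ∃ M : ℝ, 0 ≤ M ∧ ∀ x : E m, ‖app A x‖ ≤ M * ‖x‖ := by
  let L : E m →L[ℝ] E n :=
    LinearMap.toContinuousLinearMap (⟨⟨app A, app_add A⟩, app_smul A⟩ : E m →ₗ[ℝ] E n)
  exact ⟨‖L‖, norm_nonneg _, fun x => L.le_opNorm x⟩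

theorem inner_eq_sum (x y : E m) : inner ℝ x y = ∑ i, x i * y i := by
  simp [PiLp.inner_apply, mul_comm]

theorem norm_sq_eq_sum (x : E m) : ‖x‖ ^ 2 = ∑ i, x i ^ 2 := by
  simp [EuclideanSpace.norm_sq_eq]

theorem inner_app (A : Matrix (Fin n) (Fin m) ℝ) (x : E m) (y : E n) :
    inner ℝ (app A x) y = inner ℝ x (app A.transpose y) := by
  simp only [inner_eq_sum, app, Matrix.mulVec, dotProduct, Matrix.transpose_apply,
    Finset.sum_mul, Finset.mul_sum]
  rw [Finset.sum_comm]
  exact Finset.sum_congr rfl fun i _ => Finset.sum_congr rfl fun j _ => by ring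

theorem inner_le_of_abs_le {g : E m} {c : ℝ} (hg : ∀ i, |g i| ≤ c) (x : E m) :
    inner ℝ x g ≤ c * l1 x := by
  rw [inner_eq_sum, l1, Finset.mul_sum]
  refine Finset.sum_le_sum fun i _ => (le_abs_self _).trans ?_
  rw [abs_mul, mul_comm]
  exact mul_le_mul_of_nonneg_right (hg i) (abs_nonneg _)

theorem continuous_l1 : Continuous (l1 : E m → ℝ) := by
  unfold l1; fun_prop

theorem continuous_objective (A : Matrix (Fin n) (Fin m) ℝ) (b : E n) (lam : ℝ) :
    Continuous (objective A b lam) := by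
  have := continuous_app A
  have := continuous_l1 (m := m)
  unfold objective; fun_prop

theorem l1_nonneg (x : E m) : 0 ≤ l1 x := Finset.sum_nonneg fun _ _ => abs_nonneg _

theorem norm_le_l1 (x : E m) : ‖x‖ ≤ l1 x := by
  refine abs_le_of_sq_le_sq' ?_ (l1_nonneg x) |>.2
  rw [norm_sq_eq_sum, l1]
  calc ∑ i, x i ^ 2 = ∑ i, |x i| ^ 2 := by simp
    _ ≤ _ := Finset.sum_sq_le_sq_sum_of_nonneg fun _ _ => abs_nonneg _

end Basic

/-! ### Restriction to coordinate sets -/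

section Restrict

variable {m : ℕ}

/-- The vector that agrees with `x` on `S` and vanishes outside `S`. -/
noncomputable def restr (S : Finset (Fin m)) (x : E m) : E m :=
  WithLp.toLp 2 fun i => if i ∈ S then x i else 0

theorem restr_apply (S : Finset (Fin m)) (x : E m) (i : Fin m) :
    restr S x i = if i ∈ S then x i else 0 := rfl

theorem supp_restr_subset (S : Finset (Fin m)) (x : E m) : supp (restr S x) ⊆ S := by
  intro i hi
  by_contra h
  simp [supp, restr_apply, h] at hi

theorem restr_add_restr_compl (S : Finset (Fin m)) (x : E m) :
    restr S x + restr Sᶜ x = x := by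
  ext i; by_cases h : i ∈ S <;> simp [restr_apply, h]

theorem norm_sq_restr (S : Finset (Fin m)) (x : E m) :
    ‖restr S x‖ ^ 2 = ∑ i ∈ S, x i ^ 2 := by
  simp [norm_sq_eq_sum, restr_apply, ite_pow, Finset.sum_ite_mem]

theorem inner_restr (S : Finset (Fin m)) (x y : E m) :
    inner ℝ (restr S x) y = ∑ i ∈ S, x i * y i := by
  simp [inner_eq_sum, restr_apply, ite_mul, Finset.sum_ite_mem]

theorem sum_abs_le_sqrt_mul_norm_restr (S : Finset (Fin m)) (x : E m) {k : ℕ}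
    (hS : S.card ≤ k) : ∑ i ∈ S, |x i| ≤ √k * ‖restr S x‖ := by
  refine abs_le_of_sq_le_sq' ?_ (by positivity) |>.2
  rw [mul_pow, Real.sq_sqrt (Nat.cast_nonneg k), norm_sq_restr]
  refine sq_sum_le_card_mul_sum_sq.trans ?_
  simp only [sq_abs]
  gcongr

end Restrict

/-! ### Largest entries and the bathtub principle -/

section Bathtub

variable {α : Type*} [DecidableEq α]

/-- Selection of the `k` largest values of `w` on `S`, with a separating threshold `τ`. -/
theorem exists_top_subset (S : Finset α) (w : α → ℝ) (hw : ∀ i ∈ S, 0 ≤ w i) (k : ℕ) :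
    ∃ T ⊆ S, T.card ≤ k ∧ ∃ τ : ℝ, 0 ≤ τ ∧ (∀ i ∈ T, τ ≤ w i) ∧ (∀ i ∈ S \ T, w i ≤ τ) ∧
      τ * T.card = τ * k := by
  induction k with
  | zero =>
    refine ⟨∅, by simp, by simp, ∑ i ∈ S, w i, Finset.sum_nonneg hw, by simp, ?_, by simp⟩
    intro i hi
    exact Finset.single_le_sum hw (by simpa using hi)
  | succ k ih =>
    obtain ⟨T, hTS, hTk, τ, hτ, h1, h2, h3⟩ := ih
    by_cases hne : (S \ T).Nonempty
    · by_cases hτ0 : τ = 0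
      · exact ⟨T, hTS, by omega, τ, hτ, h1, h2, by simp [hτ0]⟩
      obtain ⟨j, hj, hmax⟩ := Finset.exists_max_image (S \ T) w hne
      have hj' := Finset.mem_sdiff.1 hj
      have hTk' : (T.card : ℝ) = k := mul_left_cancel₀ hτ0 h3
      have hTk'' : T.card = k := by exact_mod_cast hTk'
      refine ⟨insert j T, Finset.insert_subset hj'.1 hTS, ?_, w j, hw j hj'.1, ?_, ?_, ?_⟩
      · rw [Finset.card_insert_of_notMem hj'.2]; omega
      · intro i hi
        rcases Finset.mem_insert.1 hi with rfl | hi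
        · exact le_rfl
        · exact (h2 j hj).trans (h1 i hi)
      · intro i hi
        refine hmax i ?_
        simp only [Finset.mem_sdiff, Finset.mem_insert, not_or] at hi ⊢
        exact ⟨hi.1, hi.2.2⟩
      · rw [Finset.card_insert_of_notMem hj'.2, hTk'']
    · rw [Finset.not_nonempty_iff_eq_empty] at hne
      -- `T` exhausts `S` and may have too few elements. Threshold `0` keeps the last clause true:
      -- it says that `T` has exactly `k` elements unless `τ = 0`.
      exact ⟨T, hTS, by omega, 0, le_rfl, fun i hi => hw i (hTS hi), by simp [hne], by simp⟩

/-- The bathtub principle. -/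
theorem sum_mul_le_of_top {S T : Finset α} (hTS : T ⊆ S) {w y : α → ℝ} {k : ℕ} {τ a : ℝ}
    (hτ : 0 ≤ τ) (h1 : ∀ i ∈ T, τ ≤ w i) (h2 : ∀ i ∈ S \ T, w i ≤ τ)
    (h3 : τ * T.card = τ * k) (hy : ∀ i ∈ S, 0 ≤ y i) (hya : ∀ i ∈ S, y i ≤ a)
    (hsum : ∑ i ∈ S, y i ≤ k * a) : ∑ i ∈ S, w i * y i ≤ a * ∑ i ∈ T, w i := by
  have e1 := Finset.sum_sdiff (f := y) hTS
  have e2 := Finset.sum_sdiff (f := fun i => w i * y i) hTS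
  have b1 : ∑ i ∈ S \ T, w i * y i ≤ τ * ∑ i ∈ S \ T, y i := by
    rw [Finset.mul_sum]
    exact Finset.sum_le_sum fun i hi =>
      mul_le_mul_of_nonneg_right (h2 i hi) (hy i (Finset.sdiff_subset hi))
  have b2 : 0 ≤ ∑ i ∈ T, (w i - τ) * (a - y i) :=
    Finset.sum_nonneg fun i hi =>
      mul_nonneg (sub_nonneg.2 (h1 i hi)) (sub_nonneg.2 (hya i (hTS hi)))
  have b3 : ∑ i ∈ T, (w i - τ) * (a - y i) =
      a * ∑ i ∈ T, w i - ∑ i ∈ T, w i * y i - τ * T.card * a + τ * ∑ i ∈ T, y i := by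
    have : ∀ i, (w i - τ) * (a - y i) = a * w i - w i * y i - τ * a + τ * y i :=
      fun i => by ring
    simp only [this, Finset.sum_add_distrib, Finset.sum_sub_distrib, ← Finset.mul_sum,
      Finset.sum_const, nsmul_eq_mul]
    ring
  rw [h3] at b3
  have b4 := mul_le_mul_of_nonneg_left hsum hτ
  rw [← e1] at b4
  rw [← e2]
  linarith

end Bathtub

/-! ### Restricted isometry and restricted orthogonality -/

section RestrictedIsometry

variable {n m : ℕ}

/-- `δ` satisfies the restricted isometry inequalities for `k`-sparse vectors. -/
def IsRIPBound (A : Matrix (Fin n) (Fin m) ℝ) (k : ℕ) (δ : ℝ) : Prop :=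
  0 ≤ δ ∧ ∀ x : E m, Sparse k x →
    (1 - δ) * ‖x‖ ^ 2 ≤ ‖app A x‖ ^ 2 ∧ ‖app A x‖ ^ 2 ≤ (1 + δ) * ‖x‖ ^ 2

/-- Spares proving that the infimum is attained. The operator norm bound shows that the set of
admissible constants is nonempty. -/
theorem exists_isRIPBound_of_ric_lt {A : Matrix (Fin n) (Fin m) ℝ} {k : ℕ} {c : ℝ}
    (h : ric A k < c) : ∃ δ, δ < c ∧ IsRIPBound A k δ := by
  obtain ⟨M, hM0, hM⟩ := exists_norm_app_le A
  obtain ⟨δ, hδ, hlt⟩ := exists_lt_of_csInf_lt (s := {δ : ℝ | IsRIPBound A k δ})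
    ⟨1 + M ^ 2, by positivity, fun x _ => ⟨by nlinarith [sq_nonneg (M * ‖x‖)], by
      have := pow_le_pow_left₀ (norm_nonneg _) (hM x) 2
      nlinarith [sq_nonneg ‖x‖]⟩⟩ h
  exact ⟨δ, hlt, hδ⟩

/-- Polarization applied to `‖v‖ u ± ‖u‖ v`; the scaling gives both summands the same norm. -/
theorem IsRIPBound.inner_le {A : Matrix (Fin n) (Fin m) ℝ} {k : ℕ} {δ : ℝ}
    (h : IsRIPBound A k δ) {S S' : Finset (Fin m)} (hd : Disjoint S S')
    (hc : S.card + S'.card ≤ k) (x y : E m) :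
    inner ℝ (app A (restr S x)) (app A (restr S' y)) ≤ δ * (‖restr S x‖ * ‖restr S' y‖) := by
  set u := restr S x with hu
  set v := restr S' y with hv
  have huv : inner ℝ u v = 0 := by
    rw [hu, inner_restr]
    refine Finset.sum_eq_zero fun i hi => ?_
    simp [hv, restr_apply, Finset.disjoint_left.1 hd hi]
  have hsp : ∀ c d : ℝ, Sparse k (c • u + d • v) := by
    intro c d
    refine (Finset.card_le_card (t := S ∪ S') ?_).trans ((Finset.card_union_le _ _).trans hc)
    intro i hi
    by_contra hn
    simp only [Finset.mem_union, not_or] at hn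
    simp [supp, hu, hv, restr_apply, hn.1, hn.2] at hi
  by_cases h0 : ‖u‖ * ‖v‖ = 0
  · rcases mul_eq_zero.1 h0 with h0 | h0 <;> rw [norm_eq_zero] at h0 <;>
      simp [h0, app_zero]
  have hpos : 0 < ‖u‖ * ‖v‖ := lt_of_le_of_ne (by positivity) (Ne.symm h0)
  have h1 := (h.2 _ (hsp ‖v‖ ‖u‖)).2
  have h2 := (h.2 _ (hsp ‖v‖ (-‖u‖))).1
  simp only [app_add, app_smul, norm_add_sq_real, norm_smul, inner_smul_left, inner_smul_right,
    huv, mul_pow, norm_neg, norm_norm, conj_trivial] at h1 h2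
  refine le_of_mul_le_mul_left ?_ hpos
  nlinarith

/-- The indices of `S` whose label in `ZMod k` lies in the cyclic window `s, …, s + a - 1`. -/
def window {k : ℕ} (S : Finset (Fin m)) (p : Fin m → ZMod k) (a : ℕ) (s : ZMod k) :
    Finset (Fin m) := S.filter fun i => (p i - s).val < a

theorem card_window_le {k : ℕ} [NeZero k] {S : Finset (Fin m)} {p : Fin m → ZMod k}
    (hp : Set.InjOn p S) (a : ℕ) (s : ZMod k) : (window S p a s).card ≤ a := by
  rw [← Finset.card_range a]
  refine Finset.card_le_card_of_injOn (fun i => (p i - s).val) ?_ ?_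
  · intro i hi
    simpa using (Finset.mem_filter.1 hi).2
  · intro i hi j hj hij
    exact hp (Finset.mem_filter.1 hi).1 (Finset.mem_filter.1 hj).1
      (sub_left_injective (ZMod.val_injective k hij))

theorem card_filter_val_sub_lt {k : ℕ} [NeZero k] {a : ℕ} (ha : a ≤ k) (z : ZMod k) :
    (Finset.univ.filter fun s : ZMod k => (z - s).val < a).card = a := by
  refine (Finset.card_bij (t := Finset.range a) (fun s _ => (z - s).val) ?_ ?_ ?_).trans
    (Finset.card_range a)
  · intro s hs
    simpa using hs
  · intro s _ t _ hst
    exact sub_right_injective (ZMod.val_injective k hst)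
  · intro c hc
    rw [Finset.mem_range] at hc
    have hv : ((c : ℕ) : ZMod k).val = c := ZMod.val_cast_of_lt (hc.trans_le ha)
    exact ⟨z - c, by simp [hv, hc], by simp [hv]⟩

/-- Double counting: each label lies in exactly `a` of the `k` cyclic windows. -/
theorem sum_sum_window {k : ℕ} [NeZero k] (S : Finset (Fin m)) (p : Fin m → ZMod k) {a : ℕ}
    (ha : a ≤ k) (f : Fin m → ℝ) :
    ∑ s, ∑ i ∈ window S p a s, f i = a * ∑ i ∈ S, f i := by
  simp only [window, Finset.sum_filter]
  rw [Finset.sum_comm, Finset.mul_sum]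
  refine Finset.sum_congr rfl fun i _ => ?_
  rw [← Finset.sum_filter, Finset.sum_const, card_filter_val_sub_lt ha, nsmul_eq_mul]

theorem sum_restr_window {k : ℕ} [NeZero k] (S : Finset (Fin m)) (p : Fin m → ZMod k) {a : ℕ}
    (ha : a ≤ k) (x : E m) :
    ∑ s, restr (window S p a s) x = (a : ℝ) • restr S x := by
  ext j
  have := sum_sum_window S p ha (fun i => if i = j then x j else 0)
  simp only [Finset.sum_ite_eq'] at this
  simpa [restr_apply] using this

theorem sq_sum_norm_restr_window_le {k : ℕ} [NeZero k] (S : Finset (Fin m))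
    (p : Fin m → ZMod k) {a : ℕ} (ha : a ≤ k) (x : E m) :
    (∑ s, ‖restr (window S p a s) x‖) ^ 2 ≤ k * (a * ‖restr S x‖ ^ 2) := by
  refine sq_sum_le_card_mul_sum_sq.trans_eq ?_
  simp only [norm_sq_restr, sum_sum_window S p ha, Finset.card_univ, ZMod.card]

theorem exists_injOn_zmod {k : ℕ} [NeZero k] {S : Finset (Fin m)} (hS : S.card ≤ k) :
    ∃ p : Fin m → ZMod k, Set.InjOn p S := by
  have h : Fintype.card S ≤ Fintype.card (ZMod k) := by
    rwa [Fintype.card_coe, ZMod.card]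
  obtain ⟨f⟩ := Function.Embedding.nonempty_of_card_le h
  refine ⟨fun i => if hi : i ∈ S then f ⟨i, hi⟩ else 0, fun i hi j hj hij => ?_⟩
  have hi' : i ∈ S := hi
  have hj' : j ∈ S := hj
  simp only [hi', hj', dif_pos] at hij
  exact congrArg Subtype.val (f.injective hij)

/-- The restricted orthogonality constant of order `(k, k)` is at most `(3/√2) δ_k`. -/
theorem IsRIPBound.inner_le_of_card_le {A : Matrix (Fin n) (Fin m) ℝ} {k : ℕ} {δ : ℝ}
    (h : IsRIPBound A k δ) (hk : 2 ≤ k) {S S' : Finset (Fin m)} (hd : Disjoint S S')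
    (hS : S.card ≤ k) (hS' : S'.card ≤ k) (x y : E m) :
    inner ℝ (app A (restr S x)) (app A (restr S' y)) ≤
      2.1214 * δ * (‖restr S x‖ * ‖restr S' y‖) := by
  have : NeZero k := ⟨by omega⟩
  -- Windows of sizes `a + b = k` form pairs that the order `k` isometry controls. Averaging over
  -- all pairs costs the factor `k / √(a b)`, at most `3/√2 < 2.1214` for a balanced split, with
  -- equality at `k = 3`.
  obtain ⟨p, hp⟩ := exists_injOn_zmod hS
  obtain ⟨q, hq⟩ := exists_injOn_zmod hS'
  obtain ⟨a, b, ha, hb, hab, hsq⟩ :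
      ∃ a b : ℕ, 0 < a ∧ 0 < b ∧ a + b = k ∧ 2 * k ^ 2 ≤ 9 * (a * b) := by
    rcases Nat.even_or_odd' k with ⟨l, rfl | rfl⟩
    · exact ⟨l, l, by omega, by omega, by omega, by nlinarith⟩
    · have : 1 ≤ l := by omega
      exact ⟨l, l + 1, by omega, by omega, by omega, by nlinarith⟩
  have hsum : (a : ℝ) * b * inner ℝ (app A (restr S x)) (app A (restr S' y)) =
      ∑ s, ∑ t, inner ℝ (app A (restr (window S p a s) x)) (app A (restr (window S' q b t) y)) := by
    simp only [← inner_sum, ← app_sum]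
    rw [← sum_inner, ← app_sum, sum_restr_window S p (show a ≤ k by omega),
      sum_restr_window S' q (show b ≤ k by omega), app_smul, app_smul, inner_smul_left,
      inner_smul_right, conj_trivial]
    ring
  have hle : ∀ s t, inner ℝ (app A (restr (window S p a s) x))
      (app A (restr (window S' q b t) y)) ≤
      δ * (‖restr (window S p a s) x‖ * ‖restr (window S' q b t) y‖) := fun s t =>
    h.inner_le (hd.mono (Finset.filter_subset _ _) (Finset.filter_subset _ _))
      ((add_le_add (card_window_le hp a s) (card_window_le hq b t)).trans hab.le) x y
  have hle' : (a : ℝ) * b * inner ℝ (app A (restr S x)) (app A (restr S' y)) ≤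
      δ * ((∑ s, ‖restr (window S p a s) x‖) * ∑ t, ‖restr (window S' q b t) y‖) := by
    rw [hsum, Finset.sum_mul_sum]
    simp only [Finset.mul_sum]
    exact Finset.sum_le_sum fun s _ => Finset.sum_le_sum fun t _ => hle s t
  have hP := sq_sum_norm_restr_window_le S p (show a ≤ k by omega) x
  have hQ := sq_sum_norm_restr_window_le S' q (show b ≤ k by omega) y
  have ha' : (0 : ℝ) < a := by exact_mod_cast ha
  have hb' : (0 : ℝ) < b := by exact_mod_cast hb
  have hsq' : 2 * (k : ℝ) ^ 2 ≤ 9 * (a * b) := by exact_mod_cast hsq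
  have hPQ : (∑ s, ‖restr (window S p a s) x‖) * (∑ t, ‖restr (window S' q b t) y‖) ≤
      2.1214 * (a * b * (‖restr S x‖ * ‖restr S' y‖)) := by
    refine abs_le_of_sq_le_sq' ?_ (by positivity) |>.2
    rw [mul_pow]
    refine (mul_le_mul hP hQ (sq_nonneg _) (by positivity)).trans ?_
    have : (k : ℝ) ^ 2 * (a * b * (‖restr S x‖ ^ 2 * ‖restr S' y‖ ^ 2)) ≤
        2.1214 ^ 2 * (a * b) * (a * b * (‖restr S x‖ ^ 2 * ‖restr S' y‖ ^ 2)) :=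
      mul_le_mul_of_nonneg_right (by nlinarith [mul_pos ha' hb']) (by positivity)
    calc _ = (k : ℝ) ^ 2 * (a * b * (‖restr S x‖ ^ 2 * ‖restr S' y‖ ^ 2)) := by ring
      _ ≤ _ := this
      _ = _ := by ring
  refine le_of_mul_le_mul_left ((hle'.trans (mul_le_mul_of_nonneg_left hPQ h.1)).trans_eq ?_)
    (mul_pos ha' hb')
  ring

end RestrictedIsometry

/-! ### Stability of the restricted set -/

section Stability

variable {n m : ℕ}

/-- The cross term between a block of at most `k` coordinates and a vector on the complement whose
`ℓ∞` norm is at most `a` and whose `ℓ₁` norm is at most `k a`. -/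
theorem IsRIPBound.abs_inner_restr_compl_le {A : Matrix (Fin n) (Fin m) ℝ} {k : ℕ} {δ : ℝ}
    (hA : IsRIPBound A k δ) (hk : 2 ≤ k) {S : Finset (Fin m)} (hS : S.card ≤ k) {h : E m} {a : ℝ}
    (ha : ∀ i ∈ Sᶜ, |h i| ≤ a) (hsum : ∑ i ∈ Sᶜ, |h i| ≤ k * a) (ha0 : 0 ≤ a) :
    |inner ℝ (app A (restr Sᶜ h)) (app A (restr S h))| ≤
      a * (√k * (2.1214 * δ * ‖restr S h‖)) := by
  set c : E m := app A.transpose (app A (restr S h)) with hc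
  obtain ⟨V, hV, hVk, τ, hτ, h1, h2, h3⟩ :=
    exists_top_subset Sᶜ (fun i => |c i|) (fun i _ => abs_nonneg _) k
  have hb := sum_mul_le_of_top hV hτ h1 h2 h3 (y := fun i => |h i|)
    (fun i _ => abs_nonneg _) ha hsum
  -- Duality: testing `A h_S` against `A c_V` gives `‖c_V‖²`, so restricted orthogonality bounds
  -- `‖c_V‖`.
  have hN : ‖restr V c‖ ≤ 2.1214 * δ * ‖restr S h‖ := by
    by_cases h0 : ‖restr V c‖ = 0
    · rw [h0]
      have := hA.1
      positivity
    have hpos : 0 < ‖restr V c‖ := lt_of_le_of_ne (norm_nonneg _) (Ne.symm h0)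
    have hle := hA.inner_le_of_card_le hk
      (Finset.disjoint_left.2 fun i hi => Finset.mem_compl.1 (hV hi)) hVk hS c h
    have heq : inner ℝ (app A (restr V c)) (app A (restr S h)) = ‖restr V c‖ ^ 2 := by
      rw [inner_app, ← hc, inner_restr, norm_sq_restr]
      exact Finset.sum_congr rfl fun i _ => by ring
    refine le_of_mul_le_mul_left ?_ hpos
    rw [heq] at hle
    linarith
  rw [inner_app, ← hc, inner_restr]
  refine (Finset.abs_sum_le_sum_abs _ _).trans ?_
  simp only [abs_mul]
  calc ∑ i ∈ Sᶜ, |h i| * |c i| = ∑ i ∈ Sᶜ, |c i| * |h i| :=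
        Finset.sum_congr rfl fun i _ => mul_comm _ _
    _ ≤ a * ∑ i ∈ V, |c i| := hb
    _ ≤ a * (√k * ‖restr V c‖) := by
        gcongr
        exact sum_abs_le_sqrt_mul_norm_restr V c hVk
    _ ≤ _ := by gcongr

/-- Stability of the restricted set under a restricted isometry condition. -/
theorem IsRIPBound.norm_le_of_mem_restrictedSet {A : Matrix (Fin n) (Fin m) ℝ} {k : ℕ} {δ : ℝ}
    (hA : IsRIPBound A k δ) (hδ : δ < 0.307) (hk : 2 ≤ k) {T : Finset (Fin m)} (hT : T.card ≤ k)
    {D : ℝ} (hD1 : 1 ≤ D) (hD2 : D ≤ 1.03) {h : E m} (hh : h ∈ restrictedSet T D) {c : ℝ}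
    (hc : ∀ i, |app A.transpose (app A h) i| ≤ c) (hc0 : 0 ≤ c) : ‖h‖ ≤ 100 * (√k * c) := by
  have hk0 : (0 : ℝ) < k := by exact_mod_cast (show 0 < k by omega)
  obtain ⟨S, hS, hSk, τ, hτ, h1, h2, h3⟩ :=
    exists_top_subset Finset.univ (fun i => |h i|) (fun i _ => abs_nonneg _) k
  rw [← Finset.compl_eq_univ_sdiff] at h2
  set s := ∑ i ∈ S, |h i| with hs
  set N := ‖restr S h‖ with hN
  have hs0 : 0 ≤ s := Finset.sum_nonneg fun _ _ => abs_nonneg _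
  have hN0 : 0 ≤ N := norm_nonneg _
  have hTS : ∑ i ∈ T, |h i| ≤ s := by
    -- The bathtub principle with the indicator of `T` as weight: no `k` entries outweigh those on
    -- `S`.
    have := sum_mul_le_of_top hS hτ h1 (by rwa [← Finset.compl_eq_univ_sdiff]) h3
      (y := fun i => if i ∈ T then 1 else 0) (a := 1)
      (fun i _ => by split_ifs <;> norm_num) (fun i _ => by split_ifs <;> norm_num)
      (by simpa using hT)
    simpa using this
  have hSc : ∑ i ∈ Sᶜ, |h i| ≤ D * s := by
    have e1 := Finset.sum_add_sum_compl S fun i => |h i|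
    have e2 := Finset.sum_add_sum_compl T fun i => |h i|
    have e3 : ∑ i ∈ Tᶜ, |h i| ≤ D * ∑ i ∈ T, |h i| := hh
    nlinarith
  have hτs : τ * k ≤ s := by
    rw [← h3, mul_comm, ← nsmul_eq_mul]
    exact Finset.card_nsmul_le_sum _ _ _ h1
  have hsN : s ≤ √k * N := sum_abs_le_sqrt_mul_norm_restr S h hSk
  have hkk : √(k : ℝ) * √k = k := Real.mul_self_sqrt hk0.le
  have hcross := hA.abs_inner_restr_compl_le hk hSk (h := h) (a := D * s / k)
    (fun i hi => (h2 i hi).trans (by rw [le_div_iff₀ hk0]; nlinarith))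
    (by rwa [mul_div_cancel₀ _ hk0.ne']) (by positivity)
  have hcross' : |inner ℝ (app A (restr Sᶜ h)) (app A (restr S h))| ≤ 0.6709 * N ^ 2 := by
    refine hcross.trans ?_
    have hδ0 := hA.1
    have e1 : D * s / k * √k ≤ 1.03 * N := by
      rw [div_mul_eq_mul_div, div_le_iff₀ hk0]
      calc D * s * √k ≤ 1.03 * (√k * N) * √k := by gcongr
        _ = 1.03 * N * (√k * √k) := by ring
        _ = 1.03 * N * k := by rw [hkk]
    calc D * s / k * (√k * (2.1214 * δ * N)) = (D * s / k * √k) * (2.1214 * δ * N) := by ring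
      _ ≤ (1.03 * N) * (2.1214 * 0.307 * N) := by gcongr
      _ ≤ _ := by nlinarith [sq_nonneg N]
  have hlow := (hA.2 (restr S h) ((Finset.card_le_card (supp_restr_subset S h)).trans hSk)).1
  have hup : inner ℝ (app A (restr S h)) (app A h) ≤ c * (√k * N) := by
    rw [inner_app, inner_restr]
    calc ∑ i ∈ S, h i * app A.transpose (app A h) i ≤ ∑ i ∈ S, c * |h i| := by
          refine Finset.sum_le_sum fun i _ => (le_abs_self _).trans ?_
          rw [abs_mul, mul_comm]
          exact mul_le_mul_of_nonneg_right (hc i) (abs_nonneg _)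
      _ = c * s := by rw [Finset.mul_sum]
      _ ≤ _ := by gcongr
  have hsplit : inner ℝ (app A (restr S h)) (app A h) =
      ‖app A (restr S h)‖ ^ 2 + inner ℝ (app A (restr Sᶜ h)) (app A (restr S h)) := by
    conv_lhs => rw [← restr_add_restr_compl S h, restr_add_restr_compl S h]
    nth_rewrite 2 [← restr_add_restr_compl S h]
    rw [app_add, inner_add_right, real_inner_self_eq_norm_sq, real_inner_comm]
  -- The margin is `1 - 0.307 - 0.6709 > 0.022`, and `1 / 0.022 < 46`.
  have hNle : N ≤ 46 * (√k * c) := by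
    by_contra! hlt
    have hNpos : 0 < N := lt_of_le_of_lt (by positivity) hlt
    have e1 := (abs_le.1 hcross').1
    have e2 : (0.022 : ℝ) * N * N ≤ √k * c * N := by nlinarith [sq_nonneg N]
    have e3 := le_of_mul_le_mul_right e2 hNpos
    have : 0 ≤ √k * c := by positivity
    linarith
  have hcompl : ‖restr Sᶜ h‖ ≤ 1.03 * N := by
    refine abs_le_of_sq_le_sq' ?_ (by positivity) |>.2
    rw [norm_sq_restr]
    have e1 : ∑ i ∈ Sᶜ, h i ^ 2 ≤ τ * ∑ i ∈ Sᶜ, |h i| := by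
      rw [Finset.mul_sum]
      refine Finset.sum_le_sum fun i hi => ?_
      rw [← sq_abs, sq]
      exact mul_le_mul_of_nonneg_right (h2 i hi) (abs_nonneg _)
    refine e1.trans (le_of_mul_le_mul_right ?_ hk0)
    calc τ * (∑ i ∈ Sᶜ, |h i|) * k = (τ * k) * ∑ i ∈ Sᶜ, |h i| := by ring
      _ ≤ (√k * N) * (1.03 * (√k * N)) := by
          refine mul_le_mul (hτs.trans hsN) (hSc.trans ?_)
            (Finset.sum_nonneg fun _ _ => abs_nonneg _) (by positivity)
          gcongr
      _ = 1.03 * N ^ 2 * (√k * √k) := by ring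
      _ ≤ (1.03 * N) ^ 2 * k := by
          rw [hkk]
          exact mul_le_mul_of_nonneg_right (by nlinarith [sq_nonneg N]) hk0.le
  calc ‖h‖ = ‖restr S h + restr Sᶜ h‖ := by rw [restr_add_restr_compl]
    _ ≤ N + ‖restr Sᶜ h‖ := norm_add_le _ _
    _ ≤ 100 * (√k * c) := by
      have : 0 ≤ √k * c := by positivity
      linarith

end Stability

/-! ### Optimality conditions and error of LASSO solutions -/

section Lasso

variable {n m : ℕ} {A : Matrix (Fin n) (Fin m) ℝ} {b : E n} {lam : ℝ}

theorem objective_add (A : Matrix (Fin n) (Fin m) ℝ) (b : E n) (lam : ℝ) (x d : E m) :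
    objective A b lam (x + d) = objective A b lam x + lam * (l1 (x + d) - l1 x)
      - inner ℝ d (app A.transpose (b - app A x)) + (1 / 2) * ‖app A d‖ ^ 2 := by
  unfold objective
  rw [app_add, ← sub_sub, norm_sub_sq_real (b - app A x), ← inner_app,
    real_inner_comm (app A d) (b - app A x)]
  ring

/-- `x` minimizes the LASSO objective among the vectors vanishing outside `I`. -/
def IsMinOnSupp (A : Matrix (Fin n) (Fin m) ℝ) (b : E n) (lam : ℝ) (I : Finset (Fin m))
    (x : E m) : Prop :=
  supp x ⊆ I ∧ ∀ u : E m, supp u ⊆ I → objective A b lam x ≤ objective A b lam u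

theorem supp_subset_iff {I : Finset (Fin m)} {x : E m} : supp x ⊆ I ↔ ∀ i ∉ I, x i = 0 := by
  refine ⟨fun h i hi => ?_, fun h i hi => ?_⟩
  · by_contra h0
    exact hi (h (by simpa [supp] using h0))
  · by_contra hI
    simp [supp, h i hI] at hi

theorem nonneg_of_forall_add_mul {p c : ℝ} (h : ∀ s : ℝ, 0 < s → s ≤ 1 → 0 ≤ p + s * c) :
    0 ≤ p := by
  by_contra! hp
  have hc := h 1 one_pos le_rfl
  -- With `p < 0`, the case `s = 1` forces `c ≥ -p > 0`, so this step size is admissible and leaves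
  -- `p / 2 < 0`.
  have h2 := h (-p / (2 * c)) (by apply div_pos <;> linarith)
    (by rw [div_le_one (by linarith)]; linarith)
  have : -p / (2 * c) * c = -p / 2 := by
    have : c ≠ 0 := by intro h; linarith
    field_simp
  linarith

/-- First order condition for the restricted LASSO problem in the direction `d`. -/
theorem IsMinOnSupp.inner_le {I : Finset (Fin m)} {x d : E m} {p : ℝ} (hlam : 0 ≤ lam)
    (h : IsMinOnSupp A b lam I x) (hd : supp d ⊆ I)
    (hp : ∀ s : ℝ, 0 < s → s ≤ 1 → l1 (x + s • d) ≤ l1 x + s * p) :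
    inner ℝ d (app A.transpose (b - app A x)) ≤ lam * p := by
  rw [← sub_nonneg]
  refine nonneg_of_forall_add_mul (c := 1 / 2 * ‖app A d‖ ^ 2) fun s hs hs1 => ?_
  have hmin := h.2 (x + s • d) (supp_subset_iff.2 fun i hi => by
    simp [supp_subset_iff.1 h.1 i hi, supp_subset_iff.1 hd i hi])
  rw [objective_add, inner_smul_left, conj_trivial, app_smul, norm_smul, mul_pow,
    Real.norm_eq_abs, sq_abs] at hmin
  have := mul_le_mul_of_nonneg_left (hp s hs hs1) hlam
  refine le_of_mul_le_mul_left ?_ hs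
  nlinarith

theorem l1_add_le (x y : E m) : l1 (x + y) ≤ l1 x + l1 y := by
  rw [l1, l1, l1, ← Finset.sum_add_distrib]
  exact Finset.sum_le_sum fun i _ => abs_add_le _ _

theorem l1_smul (s : ℝ) (x : E m) : l1 (s • x) = |s| * l1 x := by
  simp [l1, abs_mul, Finset.mul_sum]

theorem IsMinOnSupp.abs_gradient_le {I : Finset (Fin m)} {x : E m} (hlam : 0 ≤ lam)
    (h : IsMinOnSupp A b lam I x) {j : Fin m} (hj : j ∈ I) :
    |app A.transpose (b - app A x) j| ≤ lam := by
  have key : ∀ c : ℝ, |c| = 1 → c * app A.transpose (b - app A x) j ≤ lam := by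
    intro c hc
    have := h.inner_le hlam (d := EuclideanSpace.single j c) (p := 1)
      (supp_subset_iff.2 fun i hi => by
        have : i ≠ j := fun hij => hi (hij ▸ hj)
        simp [this])
      (fun s hs _ => by
        refine (l1_add_le _ _).trans_eq ?_
        have : l1 (EuclideanSpace.single j c) = 1 := by
          simp [l1, apply_ite abs, hc]
        rw [l1_smul, this, abs_of_pos hs])
    rw [inner_eq_sum] at this
    simpa [Pi.single_apply] using this
  refine abs_le.2 ⟨?_, ?_⟩
  · linarith [key (-1) (by simp)]
  · linarith [key 1 (by simp)]

/-- Complementary slackness, from shrinking `x` towards `0`. -/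
theorem IsMinOnSupp.le_inner {I : Finset (Fin m)} {x : E m} (hlam : 0 ≤ lam)
    (h : IsMinOnSupp A b lam I x) :
    lam * l1 x ≤ inner ℝ x (app A.transpose (b - app A x)) := by
  have := h.inner_le hlam (d := -x) (p := -l1 x)
    (supp_subset_iff.2 fun i hi => by simp [supp_subset_iff.1 h.1 i hi])
    (fun s hs hs1 => by
      have : x + s • -x = (1 - s) • x := by module
      rw [this, l1_smul, abs_of_nonneg (by linarith)]
      linarith)
  rw [inner_neg_left] at this
  linarith

theorem isLassoSolution_of_abs_le {I : Finset (Fin m)} {x : E m} (hlam : 0 ≤ lam)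
    (h : IsMinOnSupp A b lam I x) (hg : ∀ i, |app A.transpose (b - app A x) i| ≤ lam) :
    IsLassoSolution A b lam x := by
  intro u
  have h1 := h.le_inner hlam
  have h2 := inner_le_of_abs_le hg u
  have h3 := objective_add A b lam x (u - x)
  rw [add_sub_cancel, inner_sub_left] at h3
  nlinarith [sq_nonneg ‖app A (u - x)‖]

theorem IsLassoSolution.isMinOnSupp_univ {x : E m} (h : IsLassoSolution A b lam x) :
    IsMinOnSupp A b lam Finset.univ x :=
  ⟨Finset.subset_univ _, fun u _ => h u⟩

/-- The error of a LASSO solution lies in the restricted set. -/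
theorem IsLassoSolution.sub_mem_restrictedSet {xhat xs : E m} {e : E n} {ε : ℝ} (hlam : 0 < lam)
    (hε : ε < 1) (he : ∀ j, |app A.transpose e j| ≤ ε * lam)
    (h : IsLassoSolution A (app A xhat + e) lam xs) :
    xhat - xs ∈ restrictedSet (supp xhat) ((1 + ε) / (1 - ε)) := by
  set d := xhat - xs with hd
  have h1 := h xhat
  have hres : app A xhat + e - app A xs = e + app A d := by rw [hd, app_sub]; abel
  rw [objective, objective, hres, add_sub_cancel_left, norm_add_sq_real] at h1
  -- The noise costs at most `ε * lam * l1 d`, which turns the cone constant `1` into `(1 + ε) / (1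
  -- - ε)`.
  have h2 := inner_le_of_abs_le he (-d)
  rw [inner_neg_left, ← inner_app, real_inner_comm] at h2
  have h3 : l1 xhat - l1 xs ≤ ∑ i ∈ supp xhat, |d i| - ∑ i ∈ (supp xhat)ᶜ, |d i| := by
    rw [l1, l1, ← Finset.sum_sub_distrib, ← Finset.sum_add_sum_compl (supp xhat), sub_eq_add_neg,
      ← Finset.sum_neg_distrib]
    refine add_le_add (Finset.sum_le_sum fun i _ => ?_) (Finset.sum_le_sum fun i hi => ?_)
    · exact abs_sub_abs_le_abs_sub _ _
    · have : xhat i = 0 := by simpa [supp] using hi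
      simp [hd, this]
  have h4 : l1 (-d) = ∑ i ∈ supp xhat, |d i| + ∑ i ∈ (supp xhat)ᶜ, |d i| := by
    simp [l1, Finset.sum_add_sum_compl]
  rw [h4] at h2
  change ∑ i ∈ (supp xhat)ᶜ, |d i| ≤ _
  rw [div_mul_eq_mul_div, le_div_iff₀ (by linarith)]
  refine le_of_mul_le_mul_left ?_ hlam
  nlinarith [sq_nonneg ‖app A d‖, mul_le_mul_of_nonneg_left h3 hlam.le]

theorem IsLassoSolution.norm_sub_le {xhat xs : E m} {e : E n} {ε : ℝ} {k : ℕ} (hlam : 0 < lam)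
    (hε0 : 0 ≤ ε) (hε : ε ≤ 0.01) (he : ∀ j, |app A.transpose e j| ≤ ε * lam)
    (h : IsLassoSolution A (app A xhat + e) lam xs) (hA : ric A k < 0.307) (hk : 2 ≤ k)
    (hx : Sparse k xhat) : ‖xhat - xs‖ ≤ 200 * √k * lam := by
  obtain ⟨δ, hδ, hRIP⟩ := exists_isRIPBound_of_ric_lt hA
  have hpos : (0 : ℝ) < 1 - ε := by linarith
  have hg : ∀ i, |app A.transpose (app A (xhat - xs)) i| ≤ 2 * lam := by
    intro i
    have h1 := h.isMinOnSupp_univ.abs_gradient_le hlam.le (Finset.mem_univ i)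
    have h2 : app A xhat + e - app A xs = app A (xhat - xs) + e := by rw [app_sub]; abel
    rw [h2, app_add, PiLp.add_apply] at h1
    have h3 := abs_le.1 (he i)
    have h4 := abs_le.1 h1
    have h5 : ε * lam ≤ lam := by nlinarith
    exact abs_le.2 ⟨by linarith, by linarith⟩
  -- For `ε ≤ 0.01` the ratio `(1 + ε) / (1 - ε)` stays below `1.03`; the bound `2 * lam` turns
  -- `100` into `200`.
  have := hRIP.norm_le_of_mem_restrictedSet hδ hk hx
    (by rw [le_div_iff₀ hpos]; linarith) (by rw [div_le_iff₀ hpos]; linarith)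
    (h.sub_mem_restrictedSet hlam (by linarith) he) hg (by positivity)
  linarith

end Lasso

/-! ### Convergence of general matching pursuit -/

section Run

variable {n m : ℕ} {A : Matrix (Fin n) (Fin m) ℝ} {b : E n} {lam : ℝ} {r : ℕ} {tol : ℕ → ℝ}
  {x : ℕ → E m} {I J : ℕ → Finset (Fin m)}

theorem IsRun.monotone (h : IsRun A b lam r tol x I J) : Monotone I :=
  monotone_nat_of_le_succ fun t => by
    rw [h.I_succ]
    exact Finset.subset_union_left

theorem IsRun.exists_eventually_eq (h : IsRun A b lam r tol x I J) : ∃ N, ∀ t ≥ N, I t = I N :=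
  (WellFoundedGT.monotone_chain_condition ⟨I, h.monotone⟩).imp fun _ hN t ht => (hN t ht).symm

/-- Comparison with `u = 0` bounds `lam * l1 (x t)`, so the iterates eventually stay in a compact
ball. -/
theorem IsRun.exists_mapClusterPt (hlam : 0 < lam) (h : IsRun A b lam r tol x I J) :
    ∃ xs : E m, MapClusterPt xs atTop x := by
  have hev : ∀ᶠ t in atTop, x t ∈ Metric.closedBall (0 : E m) ((objective A b lam 0 + 1) / lam) := by
    have h1 : ∀ᶠ t in atTop, tol t ≤ 1 := h.tol_tendsto.eventually_le_const one_pos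
    filter_upwards [h1, eventually_ge_atTop 1] with t ht ht1
    obtain ⟨t, rfl⟩ := Nat.exists_eq_add_of_le' ht1
    have h2 := h.master t 0 (supp_subset_iff.2 fun i _ => by simp)
    rw [mem_closedBall_zero_iff, le_div_iff₀ hlam]
    have h3 : lam * l1 (x (t + 1)) ≤ objective A b lam (x (t + 1)) :=
      le_add_of_nonneg_right (by positivity)
    have h4 := mul_le_mul_of_nonneg_left (norm_le_l1 (x (t + 1))) hlam.le
    linarith
  obtain ⟨xs, -, hxs⟩ := (isCompact_closedBall (0 : E m) _).exists_mapClusterPt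
    (tendsto_principal.2 hev)
  exact ⟨xs, hxs⟩

/-- Accumulation points of general matching pursuit are LASSO solutions. -/
theorem IsRun.isLassoSolution (hlam : 0 < lam) (hr : 1 ≤ r) (h : IsRun A b lam r tol x I J)
    {xs : E m} (hxs : MapClusterPt xs atTop x) : IsLassoSolution A b lam xs := by
  obtain ⟨N, hN⟩ := h.exists_eventually_eq
  obtain ⟨U, hU, hUx⟩ := mapClusterPt_iff_ultrafilter.1 hxs
  have hlarge : ∀ᶠ t in (U : Filter ℕ), ∃ t', t = t' + 1 ∧ N ≤ t' := by
    filter_upwards [hU (eventually_ge_atTop (N + 1))] with t ht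
    exact ⟨t - 1, by have : N + 1 ≤ t := ht; omega, by have : N + 1 ≤ t := ht; omega⟩
  have hmin : IsMinOnSupp A b lam (I N) xs := by
    refine ⟨supp_subset_iff.2 fun i hi => ?_, fun u hu => ?_⟩
    · have h1 : Tendsto (fun t => x t i) U (𝓝 (xs i)) :=
        (((EuclideanSpace.proj i : E m →L[ℝ] ℝ).continuous).tendsto xs).comp hUx
      refine tendsto_nhds_unique_of_eventuallyEq h1 tendsto_const_nhds ?_
      filter_upwards [hlarge] with t ht
      obtain ⟨t, rfl, ht⟩ := ht
      refine supp_subset_iff.1 (h.supp_subset t) i ?_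
      rwa [hN _ (by omega)]
    · have h1 := ((continuous_objective A b lam).tendsto xs).comp hUx
      have h2 : Tendsto (fun t => objective A b lam u + tol t) U (𝓝 (objective A b lam u + 0)) :=
        tendsto_const_nhds.add (h.tol_tendsto.mono_left hU)
      rw [add_zero] at h2
      refine le_of_tendsto_of_tendsto h1 h2 ?_
      filter_upwards [hlarge] with t ht
      obtain ⟨t, rfl, ht⟩ := ht
      exact h.master t u (by rwa [hN _ (by omega)])
  refine isLassoSolution_of_abs_le hlam.le hmin fun i => ?_
  have hcont : ∀ j, Tendsto (fun t => |app A.transpose (b - app A (x t)) j|) U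
      (𝓝 |app A.transpose (b - app A xs) j|) := by
    intro j
    have hc : Continuous fun y : E m => |app A.transpose (b - app A y) j| :=
      (((EuclideanSpace.proj j : E m →L[ℝ] ℝ).continuous).comp
        ((continuous_app A.transpose).comp (continuous_const.sub (continuous_app A)))).abs
    exact (hc.tendsto xs).comp hUx
  by_cases hi : i ∈ I N
  · exact hmin.abs_gradient_le hlam.le hi
  have hev : ∀ᶠ t in (U : Filter ℕ), ∃ j ∈ I N,
      |app A.transpose (b - app A (x t)) i| ≤ |app A.transpose (b - app A (x t)) j| := by
    filter_upwards [hU (eventually_ge_atTop N)] with t ht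
    have hJ : J (t + 1) ⊆ I N := by
      have ht' : N ≤ t := ht
      rw [← hN (t + 1) (by omega), h.I_succ]
      exact Finset.subset_union_right
    obtain ⟨hcard, htop⟩ := h.select t
    obtain ⟨j, hj⟩ := Finset.card_pos.1 (show 0 < (J (t + 1)).card by omega)
    exact ⟨j, hJ hj, htop j hj i fun hiJ => hi (hJ hiJ)⟩
  -- The dominating index varies with `t`; as `I N` is finite, the ultrafilter singles out one `j`.
  obtain ⟨j, hj, hjev⟩ : ∃ j ∈ I N, ∀ᶠ t in (U : Filter ℕ),
      |app A.transpose (b - app A (x t)) i| ≤ |app A.transpose (b - app A (x t)) j| :=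
    (Ultrafilter.eventually_exists_mem_iff (I N).finite_toSet).1 hev
  exact (le_of_tendsto_of_tendsto (hcont i) (hcont j) hjev).trans (hmin.abs_gradient_le hlam.le hj)

end Run

end GMP

/-! ### The main theorem -/

theorem mainTheorem1 (ν : ℝ) (hν : 0 < ν) :
    ∃ ε₀ C : ℝ, 0 < ε₀ ∧ ε₀ < 1 ∧ 0 < C ∧
      ∀ (n m k : ℕ) (A : Matrix (Fin n) (Fin m) ℝ), 2 ≤ k → k ≤ m →
        GMP.ric A k ≤ 0.307 - ν →
        ∀ xhat : GMP.E m, GMP.Sparse k xhat →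
        ∀ r : ℕ, 1 ≤ r → r ≤ m →
        -- recovery from noisy measurements
        (∀ (e : GMP.E n) (lam ε : ℝ), 0 < lam → 0 < ε → ε ≤ ε₀ →
          (∀ j, |GMP.app A.transpose e j| ≤ ε * lam) →
          ∀ (tol : ℕ → ℝ) (x : ℕ → GMP.E m) (I J : ℕ → Finset (Fin m)),
            GMP.IsRun A (GMP.app A xhat + e) lam r tol x I J →
            (∃ xs : GMP.E m, MapClusterPt xs atTop x) ∧
            ∀ xs : GMP.E m, MapClusterPt xs atTop x →
              GMP.IsLassoSolution A (GMP.app A xhat + e) lam xs ∧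
              xhat - xs ∈ GMP.restrictedSet (GMP.supp xhat) ((1 + ε) / (1 - ε)) ∧
              ‖xhat - xs‖ ≤ C * Real.sqrt k * lam) ∧
        -- recovery to any prescribed accuracy from noiseless measurements
        (∀ η : ℝ, 0 < η → ∃ lam₀ : ℝ, 0 < lam₀ ∧
          ∀ lam : ℝ, 0 < lam → lam ≤ lam₀ →
          ∀ (tol : ℕ → ℝ) (x : ℕ → GMP.E m) (I J : ℕ → Finset (Fin m)),
            GMP.IsRun A (GMP.app A xhat) lam r tol x I J →
            (∃ xs : GMP.E m, MapClusterPt xs atTop x) ∧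
            ∀ xs : GMP.E m, MapClusterPt xs atTop x → ‖xhat - xs‖ ≤ η) := by

  refine ⟨0.01, 200, by norm_num, by norm_num, by norm_num, ?_⟩
  intro n m k A hk _ hric xhat hx r hr _
  have hric' : GMP.ric A k < 0.307 := by linarith
  refine ⟨fun e lam ε hlam hε hε0 he tol x I J h => ⟨h.exists_mapClusterPt hlam, ?_⟩,
    fun η hη => ?_⟩
  · intro xs hxs
    have hsol := h.isLassoSolution hlam hr hxs
    exact ⟨hsol, hsol.sub_mem_restrictedSet hlam (by linarith) he,
      hsol.norm_sub_le hlam hε.le hε0 he hric' hk hx⟩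
  · have hsk : 0 < √(k : ℝ) := Real.sqrt_pos.2 (by exact_mod_cast (show 0 < k by omega))
    refine ⟨η / (200 * √k), by positivity, fun lam hlam hle tol x I J h =>
      ⟨h.exists_mapClusterPt hlam, fun xs hxs => ?_⟩⟩
    have hsol := h.isLassoSolution hlam hr hxs
    -- The noiseless case is `e = 0` with `ε = 0`; `lam₀` makes `200 * √k * lam` at most `η`.
    rw [← add_zero (GMP.app A xhat)] at hsol
    refine (hsol.norm_sub_le hlam (ε := 0) le_rfl (by norm_num) (fun j => ?_) hric' hk hx).trans ?_
    · simp [GMP.app_zero]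
    · rw [le_div_iff₀ (by positivity)] at hle
      linarith
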